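/- Let $a,b$ be positive integers. For a matroid $M$ of rank $k$ on a finite ground set, let $W_M(x)=\sum_{i=0}^{k}W_i\,x^i$ be its Whitney polynomial, where $W_i$ is the number of flats of $M$ of rank $i$. For $0\le k\le N$ let $U_{k,N}$ be the uniform matroid of rank $k$ on $[N]=\{1,\dots,N\}$, and for $m\ge 0$ put $U_m^{a,b}=U_{mb,\,m(a+b)}$. Let $C_n^{a,b}$ be the $(a,b)$-Catalan matroid: the matroid on $[n(a+b)]$ whose bases are the sets $T$ with $|T|=|S|$ such that, for every $i$, the $i$-th smallest element of $T$ is at most the $i$-th smallest element of $S$, where $S\subseteq[n(a+b)]$ is the set with indicator vector $(0^a,1^b,0^a,1^b,\dots,0^a,1^b)$ ($n$ blocks $0^a,1^b$). For a partition $\lambda=(\lambda_1,\dots,\lambda_\ell)\vdash n$ let $U_\lambda^{a,b}=U_{\lambda_1}^{a,b}\oplus\cdots\oplus U_{\lambda_\ell}^{a,b}$ (direct sum of matroids) and $z_\lambda=\prod_{i=1}^{n} i^{\alpha_i}\,\alpha_i!$, where $\alpha_i$ is the number of parts of $\lambda$ equal to $i$. Then for every integer $n\ge 0$ $$W_{C_n^{a,b}}(x)=\sum_{\lambda\vdash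 n}\frac{1}{z_\lambda}\,W_{U_\lambda^{a,b}}(x)$$ in $\mathbb{Q}[x]$. Moreover, for every partition $\lambda=(\lambda_1,\dots,\lambda_\ell)\vdash n$, $$W_{U_\lambda^{a,b}}(x)=\prod_{j=1}^{\ell}W_{U_{\lambda_j}^{a,b}}(x),$$ and for all integers $0\le k\le N$, $$W_{U_{k,N}}(x)=\sum_{i=0}^{k-1}\binom{N}{i}x^i+x^k .$$ -/

import Mathlib

open Polynomial
open scoped Nat

namespace CatalanMatroid

/-- The uniform matroid `U_{k,N}` (for `k ≤ N`) on the `N`-element set `Fin N`: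
its bases are the `k`-element subsets. -/
def uniform (k N : ℕ) (h : k ≤ N) : Matroid (Fin N) :=
  Matroid.ofIsBaseOfFinite (E := Set.univ) Set.finite_univ (fun B => B.ncard = k)
    (by
      obtain ⟨T, -, hT⟩ := Finset.exists_subset_card_eq
        (s := (Finset.univ : Finset (Fin N))) (n := k) (by simpa using h)
      exact ⟨T, by rw [Set.ncard_coe_finset, hT]⟩)
    (by
      intro X Y hX hY e he
      have hne : (Y \ X).Nonempty := by
        by_contra hcon
        rw [Set.not_nonempty_iff_eq_empty, Set.sdiff_eq_empty] at hcon
        have := Set.eq_of_subset_of_ncard_le hcon (by rw [hX, hY]) (Set.toFinite _)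
        exact he.2 (this ▸ he.1)
      obtain ⟨f, hf⟩ := hne
      refine ⟨f, hf, ?_⟩
      beta_reduce
      rw [Set.ncard_insert_of_notMem (fun h => hf.2 h.1) (Set.toFinite _),
        Set.ncard_sdiff_singleton_add_one he.1 (Set.toFinite _), hX])
    (fun _ _ => Set.subset_univ _)

/-- The componentwise order `T ≤ S` on finite subsets of `Fin N`: `|T| = |S|`, and the `i`-th
smallest element of `T` is at most the `i`-th smallest element of `S`, for every `i`. -/
def GaleLE {N : ℕ} (T S : Finset (Fin N)) : Prop :=
  ∃ h : T.card = S.card, ∀ i : Fin S.card, T.orderEmbOfFin h i ≤ S.orderEmbOfFin rfl i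

theorem card_filter_le_eq {N k : ℕ} (S : Finset (Fin N)) (h : S.card = k) (j : Fin N) :
    (S.filter (· ≤ j)).card =
      ((Finset.univ : Finset (Fin k)).filter (fun i => S.orderEmbOfFin h i ≤ j)).card := by
  conv_lhs => rw [← S.map_orderEmbOfFin_univ h]
  rw [Finset.filter_map, Finset.card_map]
  rfl

theorem galeLE_iff {N : ℕ} (T S : Finset (Fin N)) :
    GaleLE T S ↔ T.card = S.card ∧
      ∀ j, (S.filter (· ≤ j)).card ≤ (T.filter (· ≤ j)).card := by
  constructor
  · rintro ⟨h, hle⟩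
    refine ⟨h, fun j => ?_⟩
    rw [card_filter_le_eq S rfl, card_filter_le_eq T h]
    exact Finset.card_le_card fun i hi => by
      simp only [Finset.mem_filter, Finset.mem_univ, true_and] at hi ⊢
      exact (hle i).trans hi
  · rintro ⟨h, hle⟩
    refine ⟨h, fun i => ?_⟩
    by_contra hcon
    rw [not_le] at hcon
    have h1 := hle (S.orderEmbOfFin rfl i)
    rw [card_filter_le_eq S rfl, card_filter_le_eq T h] at h1
    have h2 : (Finset.Iic i).card ≤ ((Finset.univ : Finset (Fin S.card)).filter
        (fun l => S.orderEmbOfFin rfl l ≤ S.orderEmbOfFin rfl i)).card :=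
      Finset.card_le_card fun l hl => by simpa using hl
    have h3 : ((Finset.univ : Finset (Fin S.card)).filter
        (fun l => T.orderEmbOfFin h l ≤ S.orderEmbOfFin rfl i)).card ≤ (Finset.Iio i).card :=
      Finset.card_le_card fun l hl => by
        simp only [Finset.mem_filter, Finset.mem_univ, true_and] at hl
        simpa using hl.trans_lt hcon
    rw [Fin.card_Iic] at h2
    rw [Fin.card_Iio] at h3
    omega

theorem galeLE_exchange {N : ℕ} (S X Y : Finset (Fin N)) (hX : GaleLE X S) (hY : GaleLE Y S)
    (e : Fin N) (heX : e ∈ X) (heY : e ∉ Y) :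
    ∃ f, f ∈ Y ∧ f ∉ X ∧ GaleLE (insert f (X.erase e)) S := by
  rw [galeLE_iff] at hX hY
  have hne : (Y \ X).Nonempty := by
    by_contra hcon
    rw [Finset.not_nonempty_iff_eq_empty, Finset.sdiff_eq_empty_iff_subset] at hcon
    exact heY ((Finset.eq_of_subset_of_card_le hcon (by rw [hX.1, hY.1])) ▸ heX)
  obtain ⟨f, hf, hmin⟩ := (Y \ X).exists_min_image id hne
  rw [Finset.mem_sdiff] at hf
  refine ⟨f, hf.1, hf.2, (galeLE_iff _ _).2 ⟨?_, fun j => ?_⟩⟩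
  · have hfn : f ∉ X.erase e := fun h => hf.2 (Finset.mem_of_mem_erase h)
    rw [Finset.card_insert_of_notMem hfn, Finset.card_erase_add_one heX, hX.1]
  · by_cases hfj : f ≤ j
    · refine (hX.2 j).trans ?_
      rw [Finset.filter_insert, if_pos hfj, Finset.card_insert_of_notMem (by simp [hf.2]),
        Finset.filter_erase]
      have := Finset.pred_card_le_card_erase (s := X.filter (· ≤ j)) (a := e)
      omega
    · refine (hY.2 j).trans (Finset.card_le_card fun y hy => ?_)
      simp only [Finset.mem_filter] at hy
      have hyX : y ∈ X := by
        by_contra hcon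
        exact hfj ((hmin y (by simp [hy.1, hcon])).trans hy.2)
      have hye : y ≠ e := fun h => heY (h ▸ hy.1)
      simp [hyX, hye, hy.2]

/-- The Schubert matroid of `S ⊆ Fin N`, on ground set `Fin N`: its bases are the sets
`T ≤ S` in the componentwise order. -/
def schubert {N : ℕ} (S : Finset (Fin N)) : Matroid (Fin N) :=
  Matroid.ofIsBaseOfFinite (E := Set.univ) Set.finite_univ
    (fun B => ∃ T : Finset (Fin N), (T : Set (Fin N)) = B ∧ GaleLE T S)
    ⟨S, S, rfl, rfl, fun _ => le_rfl⟩
    (by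
      rintro _ _ ⟨X, rfl, hX⟩ ⟨Y, rfl, hY⟩ e he
      obtain ⟨f, hfY, hfX, hf⟩ := galeLE_exchange S X Y hX hY e he.1 he.2
      exact ⟨f, ⟨hfY, hfX⟩, _, by simp, hf⟩)
    (fun _ _ => Set.subset_univ _)

/-- The subset of `Fin (n * (a + b))` with indicator vector `(0^a, 1^b, 0^a, 1^b, …, 0^a, 1^b)`
(`n` blocks `0^a, 1^b`), positions being counted from `0`. -/
def catalanSet (a b n : ℕ) : Finset (Fin (n * (a + b))) :=
  Finset.univ.filter (fun p => a ≤ (p : ℕ) % (a + b))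

/-- The `(a,b)`-Catalan matroid `C_n^{a,b}`. -/
def catalan (a b n : ℕ) : Matroid (Fin (n * (a + b))) :=
  schubert (catalanSet a b n)

/-- `U_m^{a,b} = U_{mb, m(a+b)}`. -/
def uniformAB (a b m : ℕ) : Matroid (Fin (m * (a + b))) :=
  uniform (m * b) (m * (a + b)) (Nat.mul_le_mul_left m (Nat.le_add_left b a))

/-- `U_μ^{a,b}`, the direct sum of the matroids `U_{μ_i}^{a,b}` over the parts `μ_i` of the
partition `μ`, taken with multiplicity. -/
def uniformPartition (a b : ℕ) {n : ℕ} (μ : n.Partition) :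
    Matroid ((i : μ.parts) × Fin ((i : ℕ) * (a + b))) :=
  Matroid.sigma fun i : μ.parts => uniformAB a b (i : ℕ)

/-- `z_μ = ∏_{i=1}^n i^{α_i} α_i!`, where `α_i` is the number of parts of `μ` equal to `i`. -/
def zNumber {n : ℕ} (μ : n.Partition) : ℕ :=
  ∏ i ∈ Finset.Icc 1 n, i ^ μ.parts.count i * (μ.parts.count i)!

/-- The Whitney number of the second kind `W_i`: the number of flats of rank `i`
(for a matroid on a finite ground set). -/
noncomputable def whitneyNumber {α : Type*} (M : Matroid α) (i : ℕ) : ℕ :=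
  {F : Set α | M.IsFlat F ∧ M.eRk F = i}.ncard

/-- The Whitney polynomial `W_M(x) = ∑_{i=0}^k W_i x^i`, with `k` the rank of `M`
(for a matroid on a finite ground set), as a polynomial over `ℚ`. -/
noncomputable def whitneyPoly {α : Type*} (M : Matroid α) : ℚ[X] :=
  ∑ i ∈ Finset.range (M.eRank.toNat + 1), C (whitneyNumber M i : ℚ) * X ^ i

end CatalanMatroid

/-! A set is independent in the Catalan matroid iff, for each j, it has at most (n - j)b elements
from block j on (`catalan_indep_iff`). Take a basis I of a flat and let r be the first index where
this bound is tight. From block r on nothing can be added to I, so the flat contains all those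
blocks. Before r every bound is strict, so adding one element there keeps I independent, and the
flat agrees with I below block r. Hence flats correspond to pairs (r, G), with G a subset of the
first r blocks having strictly fewer than (r - j)b elements from block j on; the rank is (n - r)b +
|G|.

Building G block by block from the right, each block multiplies the generating function by g = (1 +
X)^(a+b), and the strict bound truncates it. This gives `truncIter`. The Spitzer–Baxter identity
`truncIter_eq_expCoeff` turns iterated truncation into exp(∑ (g^k mod X^(kb)) t^k/k). The full
blocks contribute 1/(1 - X^b t) = exp(∑ X^(kb) t^k/k). The exponents add up to g^k mod X^(kb) +
X^(kb), the Whitney polynomial of U_k^{a,b}, and expanding the exponential over cycle types gives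
the weights 1/z_λ. -/

namespace CatalanMatroid

/-! ### Exponentials of power series, by coefficients -/

section ExpCoeff

variable {R : Type*} [CommRing R] [Algebra ℚ R]

/-- The coefficients of the power series `exp (∑ₖ uₖ tᵏ / k)`, the sum running over `k ≥ 1`. -/
noncomputable def expCoeff (u : ℕ → R) : ℕ → R
  | 0 => 1
  | n + 1 => (1 / (n + 1 : ℚ)) • ∑ k : Fin (n + 1), u (k + 1) * expCoeff u (n - k)

theorem expCoeff_zero (u : ℕ → R) : expCoeff u 0 = 1 := by rw [expCoeff]

theorem succ_smul_expCoeff_succ (u : ℕ → R) (n : ℕ) :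
    (n + 1 : ℚ) • expCoeff u (n + 1) =
      ∑ k ∈ Finset.range (n + 1), u (k + 1) * expCoeff u (n - k) := by
  rw [expCoeff, smul_smul, mul_one_div_cancel (by positivity), one_smul,
    Finset.sum_range (fun k => u (k + 1) * expCoeff u (n - k))]

theorem eq_expCoeff (u w : ℕ → R) (h0 : w 0 = 1)
    (h : ∀ n : ℕ, (n + 1 : ℚ) • w (n + 1) =
      ∑ k ∈ Finset.range (n + 1), u (k + 1) * w (n - k)) : w = expCoeff u := by
  funext n
  induction n using Nat.strong_induction_on with
  | _ n ih =>
    rcases n with _ | n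
    · rw [h0, expCoeff_zero]
    · have hn : (n + 1 : ℚ) ≠ 0 := by positivity
      have key : (n + 1 : ℚ) • w (n + 1) = (n + 1 : ℚ) • expCoeff u (n + 1) := by
        rw [h, succ_smul_expCoeff_succ]
        exact Finset.sum_congr rfl fun k _ => by rw [ih (n - k) (by omega)]
      have := congrArg (fun z => (n + 1 : ℚ)⁻¹ • z) key
      simpa [smul_smul, inv_mul_cancel₀ hn] using this

/-- The recursion is the differential equation W' = U'W read coefficientwise, where U = ∑ uₖ tᵏ/k;
products can then be handled by the Leibniz rule. -/
theorem derivative_mk_eq_iff (u w : ℕ → R) :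
    PowerSeries.derivative R (PowerSeries.mk w) =
        PowerSeries.mk (fun k => u (k + 1)) * PowerSeries.mk w ↔
      ∀ n : ℕ, (n + 1 : ℚ) • w (n + 1) =
        ∑ k ∈ Finset.range (n + 1), u (k + 1) * w (n - k) := by
  rw [PowerSeries.ext_iff]
  refine forall_congr' fun n => ?_
  rw [PowerSeries.coeff_derivative, PowerSeries.coeff_mul,
    Finset.Nat.sum_antidiagonal_eq_sum_range_succ_mk]
  simp only [PowerSeries.coeff_mk]
  have : (n + 1 : ℚ) • w (n + 1) = w (n + 1) * (n + 1) := by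
    rw [Algebra.smul_def, mul_comm]
    simp
  rw [this]

theorem expCoeff_add (u v : ℕ → R) (n : ℕ) :
    expCoeff (u + v) n =
      ∑ k ∈ Finset.range (n + 1), expCoeff u k * expCoeff v (n - k) := by
  have hu := (derivative_mk_eq_iff u (expCoeff u)).2 (succ_smul_expCoeff_succ u)
  have hv := (derivative_mk_eq_iff v (expCoeff v)).2 (succ_smul_expCoeff_succ v)
  set w : ℕ → R := fun n => ∑ k ∈ Finset.range (n + 1), expCoeff u k * expCoeff v (n - k) with hw
  have hmk : PowerSeries.mk w = PowerSeries.mk (expCoeff u) * PowerSeries.mk (expCoeff v) := by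
    ext m
    rw [PowerSeries.coeff_mul, Finset.Nat.sum_antidiagonal_eq_sum_range_succ_mk]
    simp [hw]
  have : w = expCoeff (u + v) := by
    refine eq_expCoeff _ _ (by simp [hw, expCoeff_zero]) ((derivative_mk_eq_iff _ _).1 ?_)
    have huv : PowerSeries.mk (fun k => (u + v) (k + 1)) =
        PowerSeries.mk (fun k => u (k + 1)) + PowerSeries.mk (fun k => v (k + 1)) := by
      ext; simp
    rw [hmk, Derivation.leibniz, hu, hv, huv, smul_eq_mul, smul_eq_mul]
    ring
  rw [← this]

/-- Here the exponent is -log(1 - gt), so the series is 1/(1 - gt). -/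
theorem expCoeff_pow (g : R) (n : ℕ) : expCoeff (fun k => g ^ k) n = g ^ n := by
  refine (congrFun (eq_expCoeff (fun k => g ^ k) (fun k => g ^ k) (pow_zero g) fun n => ?_) n).symm
  rw [Finset.sum_congr rfl (g := fun _ => g ^ (n + 1)) fun k hk => by
    rw [← pow_add]
    congr 1
    have := Finset.mem_range.1 hk
    omega]
  rw [Finset.sum_const, Finset.card_range, ← Nat.cast_smul_eq_nsmul ℚ]
  simp

end ExpCoeff

/-! ### Iterated truncation and the Spitzer–Baxter identity -/

/-- The polynomials obtained by repeatedly multiplying by `g` and truncating, the degree bound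
growing by `b` at each step. -/
noncomputable def truncIter (g : ℚ[X]) (b : ℕ) : ℕ → ℚ[X]
  | 0 => 1
  | m + 1 => (g * truncIter g b m) %ₘ X ^ ((m + 1) * b)

/-- Each factor truncated at X^(kb) has degree below kb, and these bounds add up along the
recursion. The weak form is needed at m = 0, where the coefficient is 1. -/
theorem expCoeff_modByMonic_degree (g : ℚ[X]) (b m : ℕ) :
    (expCoeff (fun k => (g ^ k) %ₘ X ^ (k * b)) m).degree ≤ (m * b : ℕ) ∧
    (1 ≤ m → (expCoeff (fun k => (g ^ k) %ₘ X ^ (k * b)) m).degree < (m * b : ℕ)) := by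
  induction m using Nat.strong_induction_on with
  | _ m ih =>
    rcases m with _ | m
    · rw [expCoeff_zero]
      exact ⟨by simp, by simp⟩
    · suffices h : (expCoeff (fun k => (g ^ k) %ₘ X ^ (k * b)) (m + 1)).degree <
          ((m + 1) * b : ℕ) from ⟨h.le, fun _ => h⟩
      rw [expCoeff]
      refine (degree_smul_le _ _).trans_lt ?_
      rw [← mem_degreeLT]
      refine Submodule.sum_mem _ fun k _ => ?_
      rw [mem_degreeLT]
      have hk : (k : ℕ) + 1 + (m - k) = m + 1 := by omega
      have hb : ((m + 1) * b : ℕ) = ((k : ℕ) + 1) * b + (m - k) * b := by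
        rw [← add_mul, hk]
      rw [hb, Nat.cast_add]
      -- Adding a strict and a weak inequality of degrees fails at ⊥, so a vanishing factor is
      -- treated apart.
      rcases eq_or_ne (expCoeff (fun k => (g ^ k) %ₘ X ^ (k * b)) (m - k)) 0 with h0 | h0
      · rw [h0, mul_zero, degree_zero, ← Nat.cast_add]
        exact WithBot.bot_lt_coe _
      refine (degree_mul_le _ _).trans_lt ?_
      refine WithBot.add_lt_add_of_lt_of_le ?_ ?_ (ih (m - k) (by omega)).1
      · simpa using h0
      · simpa using degree_modByMonic_lt (g ^ ((k : ℕ) + 1))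
          (monic_X_pow (R := ℚ) (((k : ℕ) + 1) * b))

theorem pow_dvd_expCoeff_neg_sub_modByMonic (g : ℚ[X]) (b m : ℕ) :
    X ^ (m * b) ∣ expCoeff (fun k => -(g ^ k - (g ^ k) %ₘ X ^ (k * b))) m := by
  induction m using Nat.strong_induction_on with
  | _ m ih =>
    rcases m with _ | m
    · simp
    · rw [expCoeff]
      refine dvd_smul_of_dvd _ (Finset.dvd_sum fun k _ => ?_)
      have hk : (k : ℕ) + 1 + (m - k) = m + 1 := by omega
      have hb : ((m + 1) * b : ℕ) = ((k : ℕ) + 1) * b + (m - k) * b := by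
        rw [← add_mul, hk]
      rw [hb, pow_add]
      refine mul_dvd_mul ?_ (ih (m - k) (by omega))
      rw [dvd_neg]
      exact ⟨_, sub_eq_of_eq_add' (modByMonic_add_div _ _).symm⟩

/-- A form of the Spitzer–Baxter identity. -/
theorem truncIter_eq_expCoeff (g : ℚ[X]) (b m : ℕ) :
    truncIter g b m = expCoeff (fun k => (g ^ k) %ₘ X ^ (k * b)) m := by
  induction m with
  | zero => rw [truncIter, expCoeff_zero]
  | succ m ih =>
    -- Low part = all of g^k minus the high part, so P(t) = N(t)/(1 - gt), with P and N the
    -- exponentials of the low part and of the negated high part.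
    have hsplit : (fun k => (g ^ k) %ₘ X ^ (k * b)) =
        (fun k => -(g ^ k - (g ^ k) %ₘ X ^ (k * b))) + fun k => g ^ k := by
      funext k; simp
    have hconv : ∀ j, expCoeff (fun k => (g ^ k) %ₘ X ^ (k * b)) j =
        ∑ k ∈ Finset.range (j + 1),
          expCoeff (fun k => -(g ^ k - (g ^ k) %ₘ X ^ (k * b))) k * g ^ (j - k) := by
      intro j
      rw [hsplit, expCoeff_add]
      exact Finset.sum_congr rfl fun k _ => by rw [expCoeff_pow]
    -- The coefficientwise form of (1 - gt)P = N. The coefficient of N is divisible by X^((m+1)b)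
    -- and that of P has degree below (m+1)b, so reduction modulo that power leaves the recursion of
    -- `truncIter`.
    have hrec : expCoeff (fun k => (g ^ k) %ₘ X ^ (k * b)) (m + 1) =
        g * expCoeff (fun k => (g ^ k) %ₘ X ^ (k * b)) m +
          expCoeff (fun k => -(g ^ k - (g ^ k) %ₘ X ^ (k * b))) (m + 1) := by
      rw [hconv, hconv, Finset.sum_range_succ, Finset.mul_sum]
      congr 1
      · refine Finset.sum_congr rfl fun k hk => ?_
        have := Finset.mem_range.1 hk
        rw [Nat.sub_add_comm (by omega), pow_succ]
        ring
      · simp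
    have hmonic := monic_X_pow (R := ℚ) ((m + 1) * b)
    have hself := (modByMonic_eq_self_iff hmonic).2
      (show (expCoeff (fun k => (g ^ k) %ₘ X ^ (k * b)) (m + 1)).degree < _ by
        simpa using (expCoeff_modByMonic_degree g b (m + 1)).2 (by omega))
    rw [truncIter, ih, ← hself, hrec, add_modByMonic,
      (modByMonic_eq_zero_iff_dvd hmonic).2 (pow_dvd_expCoeff_neg_sub_modByMonic g b (m + 1)),
      add_zero]

/-- Adjoining the factor `1 / (1 - Xᵇ t)`. -/
theorem sum_pow_mul_truncIter (g : ℚ[X]) (b n : ℕ) :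
    ∑ r ∈ Finset.range (n + 1), X ^ ((n - r) * b) * truncIter g b r =
      expCoeff (fun k => (g ^ k) %ₘ X ^ (k * b) + X ^ (k * b)) n := by
  have : (fun k => (g ^ k) %ₘ X ^ (k * b) + X ^ (k * b)) =
      (fun k => (g ^ k) %ₘ X ^ (k * b)) + fun k => (X ^ b : ℚ[X]) ^ k := by
    funext k; simp [← pow_mul, mul_comm]
  rw [this, expCoeff_add]
  refine Finset.sum_congr rfl fun r _ => ?_
  rw [truncIter_eq_expCoeff, expCoeff_pow, ← pow_mul, mul_comm, mul_comm b]

/-! ### Partitions and the weights 1/z -/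

/-- Indices that are not parts contribute a factor 1; a common range allows partitions of different
integers to be compared. -/
theorem zNumber_eq_prod {n N : ℕ} (μ : n.Partition) (h : n ≤ N) :
    zNumber μ = ∏ i ∈ Finset.Icc 1 N, i ^ μ.parts.count i * (μ.parts.count i)! := by
  refine Finset.prod_subset (Finset.Icc_subset_Icc_right h) fun i hi hin => ?_
  rw [Multiset.count_eq_zero_of_notMem]
  · simp
  · intro hmem
    exact hin (Finset.mem_Icc.2 ⟨(Finset.mem_Icc.1 hi).1, μ.le_of_mem_parts hmem⟩)

theorem zNumber_of_cons {n m i : ℕ} (hi : 1 ≤ i) (q : m.Partition) (p : n.Partition)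
    (h : p.parts = i ::ₘ q.parts) :
    zNumber p = i * (q.parts.count i + 1) * zNumber q := by
  have hn : n = i + m := by rw [← p.parts_sum, h, Multiset.sum_cons, q.parts_sum]
  have hmem : i ∈ Finset.Icc 1 n := Finset.mem_Icc.2 ⟨hi, by omega⟩
  rw [zNumber, zNumber_eq_prod q (show m ≤ n by omega), ← Finset.mul_prod_erase _ _ hmem,
    ← Finset.mul_prod_erase _ _ hmem, h, Multiset.count_cons_self, ← mul_assoc]
  congr 1
  · rw [Nat.factorial_succ, pow_succ]; ring
  · refine Finset.prod_congr rfl fun j hj => ?_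
    rw [Multiset.count_cons_of_ne (Finset.ne_of_mem_erase hj)]

theorem sum_mul_count_parts {n : ℕ} (μ : (n + 1).Partition) :
    ∑ k ∈ Finset.range (n + 1), (k + 1) * μ.parts.count (k + 1) = n + 1 := by
  conv_rhs => rw [← μ.parts_sum, Finset.sum_multiset_count_of_subset (s := Finset.range (n + 2))
    (hs := fun i hi => Finset.mem_range.2
      (Nat.lt_succ_of_le (μ.le_of_mem_parts (Multiset.mem_toFinset.1 hi))))]
  rw [Finset.sum_range_succ' _ (n + 1)]
  simp [mul_comm]

/-- Expansion of `exp (∑ₖ uₖ tᵏ / k)` over partitions. -/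
theorem sum_partition_eq_expCoeff {R : Type*} [CommRing R] [Algebra ℚ R] (u : ℕ → R) (n : ℕ) :
    ∑ μ : n.Partition, (1 / (zNumber μ : ℚ)) • (μ.parts.map u).prod = expCoeff u n := by
  -- Only partitions containing i contribute; removing one part i is a bijection onto partitions of
  -- n - i, and by `zNumber_of_cons` the factor i·αᵢ cancels the change in z.
  have key : ∀ (n i : ℕ) (hi : 1 ≤ i) (hin : i ≤ n),
      ∑ μ : n.Partition, ((i * μ.parts.count i : ℕ) / (zNumber μ : ℚ)) • (μ.parts.map u).prod =
        u i * ∑ μ : (n - i).Partition, (1 / (zNumber μ : ℚ)) • (μ.parts.map u).prod := by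
    intro n i hi hin
    classical
    rw [← Finset.sum_subset (Finset.subset_univ (Finset.univ.filter fun μ : n.Partition =>
      i ∈ μ.parts)) fun μ _ hμ => by
        rw [Multiset.count_eq_zero_of_notMem (by simpa using hμ)]; simp,
      Finset.sum_subtype (p := fun μ : n.Partition => i ∈ μ.parts) _ (by simp),
      ← (Nat.Partition.partitionWithPartEquiv hi hin).symm.sum_comp, Finset.mul_sum]
    refine Finset.sum_congr rfl fun q _ => ?_
    rw [Nat.Partition.partitionWithPartEquiv_symm_apply_parts, zNumber_of_cons hi q _
      (Nat.Partition.partitionWithPartEquiv_symm_apply_parts hi hin q), Multiset.map_cons,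
      Multiset.prod_cons, mul_smul_comm, Multiset.count_cons_self, Nat.cast_mul _ (zNumber q),
      div_mul_eq_div_div, div_self (by positivity)]
  refine congrFun (eq_expCoeff u (fun n => ∑ μ : n.Partition,
    (1 / (zNumber μ : ℚ)) • (μ.parts.map u).prod) ?_ fun n => ?_) n
  · simp [zNumber]
  · have hk : ∀ k ∈ Finset.range (n + 1), u (k + 1) * ∑ μ : (n - k).Partition,
        (1 / (zNumber μ : ℚ)) • (μ.parts.map u).prod = ∑ μ : (n + 1).Partition,
        (((k + 1) * μ.parts.count (k + 1) : ℕ) / (zNumber μ : ℚ)) • (μ.parts.map u).prod := by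
      intro k hk
      rw [key (n + 1) (k + 1) (by omega) (by have := Finset.mem_range.1 hk; omega),
        Nat.add_sub_add_right]
    -- After exchanging the sums, each partition carries the total weight ∑ i·αᵢ = n + 1, which is
    -- the factor in the recursion.
    rw [Finset.sum_congr rfl hk, Finset.sum_comm, Finset.smul_sum]
    refine Finset.sum_congr rfl fun μ _ => ?_
    rw [← Finset.sum_smul, smul_smul, ← Finset.sum_div, mul_one_div, ← Nat.cast_sum,
      sum_mul_count_parts]
    push_cast
    rfl

end CatalanMatroid

namespace CatalanMatroid

/-! ### Flats and ranks through a basis -/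

section Flats

variable {α : Type*}

/-- F and I have the same closure, and an element outside I is in that closure exactly when adding
it to I destroys independence. -/
theorem isFlat_iff_of_isBasis {M : Matroid α} {I F : Set α} (hI : M.IsBasis I F) :
    M.IsFlat F ↔ ∀ e ∈ M.E, e ∉ F → M.Indep (insert e I) := by
  rw [M.isFlat_iff_closure_eq, ← hI.closure_eq_closure]
  constructor
  · intro h e he heF
    by_contra hcon
    refine heF (h ▸ hI.indep.mem_closure_iff.2 (Or.inl ⟨hcon, ?_⟩))
    exact Set.insert_subset he hI.indep.subset_ground
  · intro h
    refine subset_antisymm (fun e he => ?_) hI.subset_closure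
    by_contra heF
    rcases hI.indep.mem_closure_iff.1 he with h1 | h1
    · exact h1.not_indep (h e (Matroid.mem_ground_of_mem_closure he) heF)
    · exact heF (hI.subset h1)

theorem toNat_eRk_of_isBasis {M : Matroid α} {I : Finset α} {F : Set α} (hI : M.IsBasis I F) :
    (M.eRk F).toNat = I.card := by
  rw [hI.eRk_eq_encard, Set.encard_coe_eq_coe_finsetCard, ENat.toNat_natCast]

theorem exists_finset_isBasis [Finite α] (M : Matroid α) (hE : M.E = Set.univ) (F : Set α) :
    ∃ I : Finset α, M.IsBasis I F := by
  obtain ⟨I, hI⟩ := M.exists_isBasis F (by rw [hE]; exact Set.subset_univ _)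
  exact ⟨(Set.toFinite I).toFinset, by simpa using hI⟩

open Classical in
/-- The Whitney polynomial as a generating function of flats. -/
theorem whitneyPoly_eq_sum [Fintype α] (M : Matroid α) :
    whitneyPoly M = ∑ F ∈ (Finset.univ : Finset (Finset α)).filter (fun F : Finset α => M.IsFlat (F : Set α)),
      X ^ (M.eRk (F : Set α)).toNat := by
  have hfin : M.RankFinite := by
    have : M.Finite := ⟨Set.toFinite _⟩
    infer_instance
  have hmaps : ∀ F ∈ (Finset.univ : Finset (Finset α)).filter fun F : Finset α => M.IsFlat (F : Set α),
      (M.eRk (F : Set α)).toNat ∈ Finset.range (M.eRank.toNat + 1) := fun F _ =>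
    Finset.mem_range.2 (Nat.lt_succ_of_le (ENat.toNat_le_toNat (M.eRk_le_eRank _)
      (M.eRank_ne_top_iff.2 hfin)))
  rw [← Finset.sum_fiberwise_of_maps_to hmaps, whitneyPoly]
  refine Finset.sum_congr rfl fun i _ => ?_
  rw [Finset.sum_congr rfl (g := fun _ => (X : ℚ[X]) ^ i) fun F hF => by
    rw [(Finset.mem_filter.1 hF).2], Finset.sum_const, nsmul_eq_mul, whitneyNumber]
  congr 1
  rw [← C_eq_natCast]
  congr 2
  rw [← Set.ncard_coe_finset, ← Set.ncard_image_of_injective _ Finset.coe_injective]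
  congr 1
  ext F
  simp only [Set.mem_ofPred_eq, Finset.coe_filter, Set.mem_image, Finset.mem_filter,
    Finset.mem_univ, true_and]
  have htop : ∀ F : Set α, M.eRk F ≠ ⊤ := fun F =>
    ne_top_of_le_ne_top (M.eRank_ne_top_iff.2 hfin) (M.eRk_le_eRank F)
  constructor
  · rintro ⟨h1, h2⟩
    exact ⟨F.toFinset, by simp [h1, h2], by simp⟩
  · rintro ⟨F, ⟨h1, h2⟩, rfl⟩
    exact ⟨h1, by rw [← h2, ENat.natCast_toNat (htop _)]⟩

end Flats

/-! ### Uniform matroids -/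

section Uniform

theorem uniform_indep_iff {k N : ℕ} (h : k ≤ N) (I : Finset (Fin N)) :
    (uniform k N h).Indep I ↔ I.card ≤ k := by
  rw [Matroid.indep_iff]
  constructor
  · rintro ⟨B, hB, hIB⟩
    have hB : B.ncard = k := hB
    rw [← hB, ← Set.ncard_coe_finset]
    exact Set.ncard_le_ncard hIB (Set.toFinite _)
  · intro hI
    obtain ⟨B, hIB, hB⟩ := Finset.exists_superset_card_eq hI (by simpa using h)
    exact ⟨B, show (B : Set (Fin N)).ncard = k by rw [Set.ncard_coe_finset, hB],
      by exact_mod_cast hIB⟩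

theorem exists_uniform_isBasis {k N : ℕ} (h : k ≤ N) (F : Finset (Fin N)) :
    ∃ I ⊆ F, I.card = min k F.card ∧ (uniform k N h).IsBasis I F := by
  obtain ⟨I, hIF, hI⟩ := Finset.exists_subset_card_eq (min_le_right k F.card)
  refine ⟨I, hIF, hI, ?_⟩
  refine ((uniform_indep_iff h I).2 (by omega)).isBasis_of_forall_insert
    (by exact_mod_cast hIF) fun e he => ?_
  rw [Matroid.dep_iff]
  refine ⟨?_, Set.subset_univ _⟩
  have heI : e ∉ I := by simpa using he.2
  rw [← Finset.coe_insert, uniform_indep_iff, Finset.card_insert_of_notMem heI]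
  have := Finset.card_lt_card (Finset.ssubset_iff_subset_ne.2 ⟨hIF, fun h' => he.2 (h' ▸ he.1)⟩)
  omega

theorem uniform_isFlat_iff {k N : ℕ} (h : k ≤ N) (F : Finset (Fin N)) :
    (uniform k N h).IsFlat F ↔ F.card < k ∨ F = Finset.univ := by
  obtain ⟨I, hIF, hI, hb⟩ := exists_uniform_isBasis h F
  rw [isFlat_iff_of_isBasis hb]
  constructor
  · intro hF
    by_contra! hcon
    obtain ⟨e, he⟩ : ∃ e, e ∉ F := by
      by_contra! hall
      exact hcon.2 (Finset.eq_univ_iff_forall.2 hall)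
    have := hF e (Set.mem_univ e) (by simpa using he)
    rw [← Finset.coe_insert, uniform_indep_iff,
      Finset.card_insert_of_notMem fun h' => he (hIF h')] at this
    omega
  · rintro (hF | rfl) e - he
    · rw [← Finset.coe_insert, uniform_indep_iff]
      exact (Finset.card_insert_le _ _).trans (by omega)
    · simp at he

theorem whitneyPoly_uniform {k N : ℕ} (h : k ≤ N) :
    whitneyPoly (uniform k N h) = ∑ i ∈ Finset.range k, C (N.choose i : ℚ) * X ^ i + X ^ k := by
  classical
  rw [whitneyPoly_eq_sum]
  have hrk : ∀ F : Finset (Fin N), ((uniform k N h).eRk F).toNat = min k F.card := by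
    intro F
    obtain ⟨I, -, hI, hb⟩ := exists_uniform_isBasis h F
    rw [toNat_eRk_of_isBasis hb, hI]
  simp only [uniform_isFlat_iff, hrk]
  rw [Finset.filter_or, Finset.sum_union]
  · congr 1
    · rw [Finset.sum_filter]
      have := Finset.sum_powerset_apply_card
        (fun i => if i < k then (X : ℚ[X]) ^ i else 0) (x := (Finset.univ : Finset (Fin N)))
      rw [Finset.powerset_univ, Finset.card_univ, Fintype.card_fin] at this
      rw [Finset.sum_congr rfl (g := fun F : Finset (Fin N) =>
        if F.card < k then (X : ℚ[X]) ^ F.card else 0) fun F _ => by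
          split_ifs with hF
          · rw [min_eq_right hF.le]
          · rfl, this]
      rw [← Finset.sum_subset (Finset.range_subset_range.2 (show k ≤ N + 1 by omega))
        fun i _ hi => by rw [if_neg (by simpa using hi), smul_zero]]
      refine Finset.sum_congr rfl fun i hi => ?_
      rw [if_pos (Finset.mem_range.1 hi), nsmul_eq_mul, map_natCast]
    · rw [Finset.filter_eq', if_pos (Finset.mem_univ _), Finset.sum_singleton, Finset.card_univ,
        Fintype.card_fin, min_eq_left h]
  · rw [Finset.disjoint_filter]
    rintro F - hF rfl
    rw [Finset.card_univ, Fintype.card_fin] at hF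
    omega

/-- The form in which the uniform summands match the exponents produced by the Spitzer–Baxter
identity. -/
theorem whitneyPoly_uniform_eq_modByMonic {k N : ℕ} (h : k ≤ N) :
    whitneyPoly (uniform k N h) = (1 + X) ^ N %ₘ X ^ k + X ^ k := by
  rw [whitneyPoly_uniform, add_comm 1, (div_modByMonic_unique
    (∑ i ∈ Finset.range (N + 1 - k), C (N.choose (k + i) : ℚ) * X ^ i)
    (∑ i ∈ Finset.range k, C (N.choose i : ℚ) * X ^ i) (monic_X_pow k) ⟨?_, ?_⟩).2]
  · rw [add_pow, Finset.mul_sum]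
    conv_rhs => rw [← Nat.add_sub_of_le (show k ≤ N + 1 by omega), Finset.sum_range_add]
    simp only [one_pow, mul_one, map_natCast, pow_add]
    congr 1
    · exact Finset.sum_congr rfl fun i _ => by ring
    · exact Finset.sum_congr rfl fun i _ => by ring
  · rw [degree_X_pow, ← mem_degreeLT]
    refine Submodule.sum_mem _ fun i hi => ?_
    rw [mem_degreeLT]
    exact (degree_C_mul_X_pow_le _ _).trans_lt (by exact_mod_cast Finset.mem_range.1 hi)

end Uniform

/-! ### Direct sums -/

section Sigma

variable {ι : Type*} [Fintype ι] {α : ι → Type*} [∀ i, Fintype (α i)]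

theorem exists_sigma_isBasis (M : ∀ i, Matroid (α i)) (hE : ∀ i, (M i).E = Set.univ)
    (f : ∀ i, Finset (α i)) :
    ∃ I : ∀ i, Finset (α i), (∀ i, (M i).IsBasis (I i) (f i)) ∧
      (Matroid.sigma M).IsBasis (Finset.univ.sigma I : Finset ((i : ι) × α i))
        (Finset.univ.sigma f : Finset ((i : ι) × α i)) := by
  choose I hI using fun i => exists_finset_isBasis (M i) (hE i) (f i)
  refine ⟨I, hI, Matroid.sigma_isBasis_iff.2 fun i => ?_⟩
  rw [Finset.coe_sigma, Finset.coe_sigma, Finset.coe_univ, Set.mk_preimage_sigma (Set.mem_univ i),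
    Set.mk_preimage_sigma (Set.mem_univ i)]
  exact hI i

theorem toNat_eRk_sigma (M : ∀ i, Matroid (α i)) (hE : ∀ i, (M i).E = Set.univ)
    (f : ∀ i, Finset (α i)) :
    ((Matroid.sigma M).eRk (Finset.univ.sigma f : Finset ((i : ι) × α i))).toNat =
      ∑ i, ((M i).eRk (f i)).toNat := by
  obtain ⟨I, hI, hb⟩ := exists_sigma_isBasis M hE f
  rw [toNat_eRk_of_isBasis hb, Finset.card_sigma]
  exact Finset.sum_congr rfl fun i _ => (toNat_eRk_of_isBasis (hI i)).symm

theorem sigma_isFlat_iff (M : ∀ i, Matroid (α i)) (hE : ∀ i, (M i).E = Set.univ)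
    (f : ∀ i, Finset (α i)) :
    (Matroid.sigma M).IsFlat (Finset.univ.sigma f : Finset ((i : ι) × α i)) ↔
      ∀ i, (M i).IsFlat (f i) := by
  classical
  obtain ⟨I, hI, hb⟩ := exists_sigma_isBasis M hE f
  rw [isFlat_iff_of_isBasis hb]
  -- Inserting an element changes only the fibre it lies in; the other fibres stay independent
  -- bases.
  have hins : ∀ (i : ι) (e : α i), (Matroid.sigma M).Indep
      (insert ⟨i, e⟩ ((Finset.univ.sigma I : Finset ((i : ι) × α i)) : Set ((i : ι) × α i))) ↔
      (M i).Indep (insert e (I i : Set (α i))) := by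
    intro i e
    rw [Matroid.sigma_indep_iff]
    have hself : Sigma.mk i ⁻¹' (insert ⟨i, e⟩
        ((Finset.univ.sigma I : Finset ((i : ι) × α i)) : Set ((i : ι) × α i))) =
        insert e (I i : Set (α i)) := by
      ext x; simp
    constructor
    · intro h
      exact hself ▸ h i
    · intro h j
      rcases eq_or_ne j i with rfl | hj
      · rwa [hself]
      · refine (hI j).indep.subset fun x hx => ?_
        simpa [hj] using hx
  constructor
  · intro h i
    rw [isFlat_iff_of_isBasis (hI i)]
    intro e he hef
    exact (hins i e).1 (h ⟨i, e⟩ (by simpa using he) (by simpa using hef))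
  · rintro h ⟨i, e⟩ he hef
    exact (hins i e).2 ((isFlat_iff_of_isBasis (hI i)).1 (h i) e (by simpa using he)
      (by simpa using hef))

theorem whitneyPoly_sigma (M : ∀ i, Matroid (α i)) (hE : ∀ i, (M i).E = Set.univ) :
    whitneyPoly (Matroid.sigma M) = ∏ i, whitneyPoly (M i) := by
  classical
  simp only [whitneyPoly_eq_sum]
  rw [Finset.prod_univ_sum]
  symm
  refine Finset.sum_bij' (fun f _ => Finset.univ.sigma f)
    (fun F _ i => F.preimage (Sigma.mk i) sigma_mk_injective.injOn) ?_ ?_ ?_ ?_ ?_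
  · intro f hf
    rw [Finset.mem_filter, sigma_isFlat_iff M hE]
    simpa using hf
  · intro F hF
    rw [Fintype.mem_piFinset]
    have hFs : F = Finset.univ.sigma
        fun i => F.preimage (Sigma.mk i) sigma_mk_injective.injOn := by
      ext ⟨i, e⟩; simp
    rw [Finset.mem_filter, hFs, sigma_isFlat_iff M hE] at hF
    simpa using hF.2
  · intro f _
    ext i e; simp
  · intro F _
    ext ⟨i, e⟩; simp
  · intro f _
    rw [toNat_eRk_sigma M hE, Finset.prod_pow_eq_pow_sum]

theorem whitneyPoly_uniformPartition (a b : ℕ) {n : ℕ} (μ : n.Partition) :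
    whitneyPoly (uniformPartition a b μ) =
      (μ.parts.map fun m => whitneyPoly (uniformAB a b m)).prod := by
  rw [uniformPartition, whitneyPoly_sigma _ fun _ => rfl,
    ← μ.parts.map_univ fun m => whitneyPoly (uniformAB a b m)]
  rfl

end Sigma

end CatalanMatroid

namespace CatalanMatroid

/-! ### Tails of sets and independence in Schubert matroids -/

section Segments

variable {N : ℕ}

/-- The elements of `A` that are at least `q`. -/
def tail (A : Finset (Fin N)) (q : ℕ) : Finset (Fin N) := A.filter fun p => q ≤ (p : ℕ)

/-- The elements `p` of `Fin N` with `u ≤ p < v`. -/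
def seg (N u v : ℕ) : Finset (Fin N) := Finset.univ.filter fun p => u ≤ (p : ℕ) ∧ (p : ℕ) < v

@[simp] theorem mem_tail {A : Finset (Fin N)} {q : ℕ} {p : Fin N} :
    p ∈ tail A q ↔ p ∈ A ∧ q ≤ (p : ℕ) := Finset.mem_filter

@[simp] theorem mem_seg {u v : ℕ} {p : Fin N} : p ∈ seg N u v ↔ u ≤ (p : ℕ) ∧ (p : ℕ) < v := by
  simp [seg]

theorem card_seg {u v : ℕ} (h : v ≤ N) : (seg N u v).card = v - u := by
  rw [← Nat.card_Ico, ← Finset.card_map Fin.valEmbedding]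
  congr 1
  ext x
  simp only [Finset.mem_map, mem_seg, Fin.valEmbedding_apply, Finset.mem_Ico]
  constructor
  · rintro ⟨p, hp, rfl⟩
    exact hp
  · intro hx
    exact ⟨⟨x, by omega⟩, hx, rfl⟩

theorem tail_mono {A B : Finset (Fin N)} (h : A ⊆ B) (q : ℕ) : tail A q ⊆ tail B q :=
  Finset.filter_subset_filter _ h

theorem tail_antitone (A : Finset (Fin N)) {q r : ℕ} (h : q ≤ r) : tail A r ⊆ tail A q := by
  intro p hp
  rw [mem_tail] at hp ⊢
  exact ⟨hp.1, h.trans hp.2⟩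

theorem tail_of_le (A : Finset (Fin N)) {q : ℕ} (h : N ≤ q) : tail A q = ∅ := by
  refine Finset.eq_empty_of_forall_notMem fun p hp => ?_
  have := (mem_tail.1 hp).2
  omega

theorem tail_insert_of_lt (A : Finset (Fin N)) {q : ℕ} {e : Fin N} (h : (e : ℕ) < q) :
    tail (insert e A) q = tail A q := by
  rw [tail, Finset.filter_insert, if_neg (by omega), tail]

theorem card_tail_insert_of_le {A : Finset (Fin N)} {q : ℕ} {e : Fin N} (h : q ≤ (e : ℕ))
    (he : e ∉ A) : (tail (insert e A) q).card = (tail A q).card + 1 := by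
  rw [tail, Finset.filter_insert, if_pos h, Finset.card_insert_of_notMem (by simp [he]), tail]

theorem card_tail_insert_le (A : Finset (Fin N)) (q : ℕ) (e : Fin N) :
    (tail (insert e A) q).card ≤ (tail A q).card + 1 := by
  by_cases h : q ≤ (e : ℕ)
  · rw [tail, Finset.filter_insert, if_pos h]
    exact Finset.card_insert_le _ _
  · rw [tail_insert_of_lt A (by omega)]
    omega

theorem card_tail_eq_add (A : Finset (Fin N)) {q r : ℕ} (h : q ≤ r) :
    (tail A q).card = (A ∩ seg N q r).card + (tail A r).card := by
  rw [← Finset.card_union_of_disjoint]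
  · congr 1
    ext p
    simp only [mem_tail, Finset.mem_union, Finset.mem_inter, mem_seg]
    by_cases hp : p ∈ A <;> simp [hp]
    omega
  · rw [Finset.disjoint_left]
    intro p hp hp'
    simp only [mem_tail, Finset.mem_inter, mem_seg] at hp hp'
    omega

/-- For equal cardinalities, more elements up to j means fewer after j. Unlike initial counts, tail
bounds pass to subsets, so they can describe independent sets. -/
theorem galeLE_iff_tail (T S : Finset (Fin N)) :
    GaleLE T S ↔ T.card = S.card ∧ ∀ q, (tail T q).card ≤ (tail S q).card := by
  have hsplit : ∀ (A : Finset (Fin N)) (j : Fin N),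
      (A.filter (· ≤ j)).card + (tail A (j + 1)).card = A.card := by
    intro A j
    rw [← Finset.card_filter_add_card_filter_not (s := A) (· ≤ j)]
    congr 2
    refine Finset.filter_congr fun p _ => ?_
    rw [not_le, Fin.lt_def]
    omega
  rw [galeLE_iff]
  refine and_congr_right fun hc => ⟨fun h q => ?_, fun h j => ?_⟩
  · rcases q with _ | q
    · simp [tail, hc]
    · by_cases hq : q < N
      · have h1 := hsplit T ⟨q, hq⟩
        have h2 := hsplit S ⟨q, hq⟩
        have h3 := h ⟨q, hq⟩
        simp only at h1 h2
        omega
      · rw [tail_of_le T (by omega), Finset.card_empty]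
        exact Nat.zero_le _
  · have h1 := hsplit T j
    have h2 := hsplit S j
    have h3 := h (j + 1)
    omega

/-- Greedy completion: add the smallest missing element e. Below e the set is full, so for q ≤ e it
has at least as many elements below q as S; since it has fewer elements in total, its tail at q has
room for one more. -/
theorem exists_galeLE_superset (S : Finset (Fin N)) (I : Finset (Fin N))
    (hI : ∀ q, (tail I q).card ≤ (tail S q).card) : ∃ T, I ⊆ T ∧ GaleLE T S := by
  have hcard : ∀ A : Finset (Fin N), tail A 0 = A := fun A => by ext; simp
  induction hd : S.card - I.card generalizing I with
  | zero =>
    refine ⟨I, subset_rfl, (galeLE_iff_tail I S).2 ⟨?_, hI⟩⟩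
    have := hI 0
    rw [hcard, hcard] at this
    omega
  | succ d ih =>
    have hlt : I.card < S.card := by omega
    have hne : Iᶜ.Nonempty := by
      rw [Finset.nonempty_iff_ne_empty, Ne, Finset.compl_eq_empty_iff]
      rintro rfl
      exact absurd (Finset.card_le_univ S) (not_le.2 hlt)
    obtain ⟨e, he, hmin⟩ := Iᶜ.exists_min_image id hne
    rw [Finset.mem_compl] at he
    obtain ⟨T, hT, hTS⟩ := ih (insert e I) (fun q => by
      by_cases hq : q ≤ (e : ℕ)
      · rw [card_tail_insert_of_le hq he]
        have h1 := card_tail_eq_add I (Nat.zero_le q)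
        have h2 := card_tail_eq_add S (Nat.zero_le q)
        rw [hcard] at h1 h2
        have h3 : S ∩ seg N 0 q ⊆ I ∩ seg N 0 q := by
          intro p hp
          rw [Finset.mem_inter, mem_seg] at hp ⊢
          refine ⟨?_, hp.2⟩
          by_contra hpI
          have : (e : ℕ) ≤ p := hmin p (by simpa using hpI)
          omega
        have := Finset.card_le_card h3
        omega
      · rw [tail_insert_of_lt I (by omega)]
        exact hI q) (by rw [Finset.card_insert_of_notMem he]; omega)
    exact ⟨T, (Finset.subset_insert e I).trans hT, hTS⟩

theorem schubert_indep_iff (S I : Finset (Fin N)) :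
    (schubert S).Indep I ↔ ∀ q, (tail I q).card ≤ (tail S q).card := by
  rw [Matroid.indep_iff]
  constructor
  · rintro ⟨_, ⟨T, rfl, hT⟩, hIT⟩ q
    exact (Finset.card_le_card (tail_mono (by exact_mod_cast hIT) q)).trans
      (((galeLE_iff_tail T S).1 hT).2 q)
  · intro hI
    obtain ⟨T, hIT, hT⟩ := exists_galeLE_superset S I hI
    exact ⟨T, ⟨T, rfl, hT⟩, by exact_mod_cast hIT⟩

end Segments

/-! ### Independent sets and flats of the Catalan matroid -/

section Catalan

variable {a b n : ℕ}

theorem catalanSet_inter_seg {j q : ℕ} (hq : j * (a + b) ≤ q) :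
    catalanSet a b n ∩ seg _ q ((j + 1) * (a + b)) =
      seg _ (max q (j * (a + b) + a)) ((j + 1) * (a + b)) := by
  ext p
  rw [Finset.mem_inter, mem_seg, mem_seg, catalanSet, Finset.mem_filter, add_mul, one_mul, max_le_iff]
  simp only [Finset.mem_univ, true_and]
  have key : j * (a + b) ≤ (p : ℕ) → (p : ℕ) < j * (a + b) + (a + b) →
      (p : ℕ) % (a + b) = p - j * (a + b) := by
    intro h1 h2
    rw [← Nat.mod_eq_of_lt (show (p : ℕ) - j * (a + b) < a + b by omega)]
    conv_lhs => rw [← Nat.sub_add_cancel h1, Nat.add_mul_mod_self_right]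
  constructor
  · rintro ⟨h1, h2, h3⟩
    rw [key (hq.trans h2) h3] at h1
    omega
  · rintro ⟨⟨h1, h2⟩, h3⟩
    rw [key (hq.trans h1) h3]
    omega

theorem card_tail_catalanSet {j : ℕ} (hj : j ≤ n) :
    (tail (catalanSet a b n) (j * (a + b))).card = (n - j) * b := by
  induction hd : n - j generalizing j with
  | zero =>
    rw [tail_of_le _ (Nat.mul_le_mul_right _ (show n ≤ j by omega))]
    simp
  | succ d ih =>
    have hle : (j + 1) * (a + b) ≤ n * (a + b) := Nat.mul_le_mul_right _ (by omega)
    rw [card_tail_eq_add _ (Nat.mul_le_mul_right (a + b) (show j ≤ j + 1 by omega)),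
      catalanSet_inter_seg le_rfl, card_seg hle, ih (by omega) (by omega), add_mul, one_mul,
      max_eq_right (by omega), add_mul d, one_mul]
    omega

/-- Only tails starting at a block boundary matter. For q in block j, the tail of `catalanSet` at q
has (n - j - 1)b + min(b, (j+1)(a+b) - q) elements. Either value of the minimum bounds the tail of
I: one by the condition at j, the other by the condition at j + 1 together with the number of
positions left in the block. -/
theorem catalan_indep_iff (I : Finset (Fin (n * (a + b)))) :
    (catalan a b n).Indep I ↔ ∀ j ≤ n, (tail I (j * (a + b))).card ≤ (n - j) * b := by
  rw [catalan, schubert_indep_iff]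
  constructor
  · intro h j hj
    rw [← card_tail_catalanSet hj]
    exact h _
  · intro h q
    by_cases hq : n * (a + b) ≤ q
    · rw [tail_of_le I hq, Finset.card_empty]
      exact Nat.zero_le _
    · have hc : 0 < a + b := by
        by_contra h0
        exact hq (by simp [show a + b = 0 by omega])
      have h1 : q / (a + b) * (a + b) ≤ q := Nat.div_mul_le_self _ _
      have h2 : q < (q / (a + b) + 1) * (a + b) := by
        rw [add_mul, one_mul]
        exact Nat.lt_div_mul_add hc
      have hjn : q / (a + b) < n := by
        rw [Nat.div_lt_iff_lt_mul hc]; omega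
      set j := q / (a + b) with hjdef
      have hle : (j + 1) * (a + b) ≤ n * (a + b) := Nat.mul_le_mul_right _ hjn
      rw [card_tail_eq_add (catalanSet a b n) h2.le, catalanSet_inter_seg h1, card_seg hle,
        card_tail_catalanSet (show j + 1 ≤ n from hjn)]
      have h3 := h j hjn.le
      have h4 := h (j + 1) hjn
      have h5 := Finset.card_le_card (tail_antitone I h1)
      have h6 := card_tail_eq_add I h2.le
      have h7 := Finset.card_le_card
        (Finset.inter_subset_right (s₁ := I) (s₂ := seg _ q ((j + 1) * (a + b))))
      rw [card_seg hle] at h7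
      have h8 : (n - j) * b = (n - (j + 1)) * b + b := by
        rw [show n - j = n - (j + 1) + 1 by omega, add_mul, one_mul]
      have h9 : (j + 1) * (a + b) = j * (a + b) + (a + b) := by ring
      omega

/-- The subsets `G` of the blocks `i, …, m - 1` having fewer than `(m - j) * b` elements in the
blocks `j, …, m - 1`, for every `j`. -/
def ballotSets (a b n i m : ℕ) : Finset (Finset (Fin (n * (a + b)))) :=
  (seg _ (i * (a + b)) (m * (a + b))).powerset.filter fun G =>
    ∀ j ∈ Finset.Ico i m, (tail G (j * (a + b))).card < (m - j) * b

theorem mem_ballotSets {i m : ℕ} {G : Finset (Fin (n * (a + b)))} :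
    G ∈ ballotSets a b n i m ↔ G ⊆ seg _ (i * (a + b)) (m * (a + b)) ∧
      ∀ j, i ≤ j → j < m → (tail G (j * (a + b))).card < (m - j) * b := by
  simp [ballotSets]

/-- The set made of `G` and of all the blocks from the `r`-th on. -/
def addBlocks (a b n r : ℕ) (G : Finset (Fin (n * (a + b)))) : Finset (Fin (n * (a + b))) :=
  G ∪ seg _ (r * (a + b)) (n * (a + b))

theorem tail_union (A B : Finset (Fin n)) (q : ℕ) : tail (A ∪ B) q = tail A q ∪ tail B q :=
  Finset.filter_union _ _ _

theorem tail_tail_of_le (A : Finset (Fin n)) {q r : ℕ} (h : q ≤ r) :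
    tail (tail A r) q = tail A r := by
  ext p
  simp only [mem_tail, and_assoc]
  exact and_congr_right fun _ => by omega

theorem tail_tail_of_ge (A : Finset (Fin n)) {q r : ℕ} (h : r ≤ q) :
    tail (tail A r) q = tail A q := by
  ext p
  simp only [mem_tail, and_assoc]
  exact and_congr_right fun _ => by omega

theorem tail_eq_empty_of_subset_seg {A : Finset (Fin n)} {u v : ℕ} (h : A ⊆ seg n u v) :
    tail A v = ∅ := by
  refine Finset.eq_empty_of_forall_notMem fun p hp => ?_
  have h1 := mem_tail.1 hp
  have h2 := mem_seg.1 (h h1.1)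
  omega

/-- The basis used is G together with the part of `catalanSet` from block r on. Its bounds are tight
from r on, which blocks any addition there, and strict before r, which permits any single addition
below. -/
theorem addBlocks_flat {r : ℕ} (hr : r ≤ n) {G : Finset (Fin (n * (a + b)))}
    (hG : G ∈ ballotSets a b n 0 r) :
    (catalan a b n).IsFlat (addBlocks a b n r G : Finset _) ∧
      ((catalan a b n).eRk (addBlocks a b n r G : Finset _)).toNat = (n - r) * b + G.card := by
  rw [mem_ballotSets] at hG
  obtain ⟨hsub, hG⟩ := hG
  have hdisj : Disjoint G (tail (catalanSet a b n) (r * (a + b))) := by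
    rw [Finset.disjoint_left]
    intro p hp hp'
    have h1 := mem_seg.1 (hsub hp)
    have h2 := (mem_tail.1 hp').2
    omega
  set I := G ∪ tail (catalanSet a b n) (r * (a + b)) with hI
  have hIcard : I.card = (n - r) * b + G.card := by
    rw [hI, Finset.card_union_of_disjoint hdisj, card_tail_catalanSet hr, add_comm]
  have htail_ge : ∀ j, r ≤ j → j ≤ n → (tail I (j * (a + b))).card = (n - j) * b := by
    intro j hj hjn
    rw [hI, tail_union, tail_tail_of_ge _ (Nat.mul_le_mul_right (a + b) hj), ← card_tail_catalanSet hjn,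
      Finset.subset_empty.1 ((tail_antitone G (Nat.mul_le_mul_right (a + b) hj)).trans
        (tail_eq_empty_of_subset_seg hsub).subset), Finset.empty_union]
  have htail_lt : ∀ j, j < r → (tail I (j * (a + b))).card < (n - j) * b := by
    intro j hj
    have h1 := hG j (Nat.zero_le _) hj
    have h2 := Finset.card_union_le (tail G (j * (a + b))) (tail (catalanSet a b n) (r * (a + b)))
    rw [card_tail_catalanSet hr] at h2
    rw [hI, tail_union, tail_tail_of_le _ (Nat.mul_le_mul_right (a + b) hj.le)]
    have h3 : (n - j) * b = (r - j) * b + (n - r) * b := by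
      rw [← add_mul]; congr 1; omega
    omega
  have hindep : (catalan a b n).Indep I := by
    rw [catalan_indep_iff]
    intro j hj
    rcases lt_or_ge j r with h | h
    · exact (htail_lt j h).le
    · exact (htail_ge j h hj).le
  have hIF : I ⊆ addBlocks a b n r G := by
    intro p hp
    rw [hI, Finset.mem_union, mem_tail] at hp
    rw [addBlocks, Finset.mem_union, mem_seg]
    exact hp.imp id fun h => ⟨h.2, p.2⟩
  have hbasis : (catalan a b n).IsBasis I (addBlocks a b n r G : Finset _) := by
    refine hindep.isBasis_of_forall_insert (by exact_mod_cast hIF) fun e he => ?_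
    rw [Matroid.dep_iff]
    refine ⟨fun hcon => ?_, Set.subset_univ _⟩
    have heI : e ∉ I := by simpa using he.2
    have her : r * (a + b) ≤ (e : ℕ) := by
      have h1 : e ∈ addBlocks a b n r G := by simpa using he.1
      rw [addBlocks, Finset.mem_union, mem_seg] at h1
      rcases h1 with h1 | h1
      · exact absurd (Finset.mem_union_left _ h1) heI
      · exact h1.1
    rw [← Finset.coe_insert, catalan_indep_iff] at hcon
    have h1 := hcon r hr
    rw [card_tail_insert_of_le her heI, htail_ge r le_rfl hr] at h1
    omega
  refine ⟨(isFlat_iff_of_isBasis hbasis).2 fun e _ he => ?_, by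
    rw [toNat_eRk_of_isBasis hbasis, hIcard]⟩
  rw [← Finset.coe_insert, catalan_indep_iff]
  have her : (e : ℕ) < r * (a + b) := by
    by_contra hcon
    refine he ?_
    rw [Finset.mem_coe, addBlocks, Finset.mem_union, mem_seg]
    exact Or.inr ⟨not_lt.1 hcon, e.2⟩
  intro j hj
  rcases lt_or_ge j r with h | h
  · exact (card_tail_insert_le I _ e).trans (htail_lt j h)
  · rw [tail_insert_of_lt I (her.trans_le (Nat.mul_le_mul_right (a + b) h))]
    exact (htail_ge j h hj).le

theorem exists_eq_addBlocks_of_isFlat {F : Finset (Fin (n * (a + b)))}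
    (hF : (catalan a b n).IsFlat F) :
    ∃ r ≤ n, ∃ G ∈ ballotSets a b n 0 r, addBlocks a b n r G = F := by
  obtain ⟨I, hI⟩ := exists_finset_isBasis (catalan a b n) rfl (F : Set _)
  have hindep := (catalan_indep_iff I).1 hI.indep
  have hIF : I ⊆ F := by exact_mod_cast hI.subset
  rw [isFlat_iff_of_isBasis hI] at hF
  -- The bound at n is always tight, both sides being 0, so a first tight index exists.
  have hex : ∃ r, r ≤ n ∧ (tail I (r * (a + b))).card = (n - r) * b :=
    ⟨n, le_rfl, by rw [tail_of_le I le_rfl]; simp⟩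
  classical
  obtain ⟨hr, htight⟩ := Nat.find_spec hex
  have hmin : ∀ j, j < Nat.find hex → (tail I (j * (a + b))).card < (n - j) * b := fun j hj =>
    lt_of_le_of_ne (hindep j (by omega)) fun h => Nat.find_min hex hj ⟨by omega, h⟩
  set r := Nat.find hex
  have hlow : ∀ e ∈ F, (e : ℕ) < r * (a + b) → e ∈ I := by
    intro e heF her
    have : (catalan a b n).Indep (insert e I : Finset _) := by
      rw [catalan_indep_iff]
      intro j hj
      rcases lt_or_ge j r with h | h
      · exact (card_tail_insert_le I _ e).trans (hmin j h)
      · rw [tail_insert_of_lt I (her.trans_le (Nat.mul_le_mul_right _ h))]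
        exact hindep j hj
    rw [Finset.coe_insert] at this
    exact_mod_cast hI.mem_of_insert_indep (by exact_mod_cast heF) this
  have hhigh : ∀ e : Fin (n * (a + b)), r * (a + b) ≤ (e : ℕ) → e ∈ F := by
    intro e her
    by_contra heF
    have h1 := hF e (Set.mem_univ _) (by exact_mod_cast heF)
    rw [← Finset.coe_insert, catalan_indep_iff] at h1
    have h2 := h1 r hr
    rw [card_tail_insert_of_le her fun h => heF (hIF h), htight] at h2
    omega
  refine ⟨r, hr, F ∩ seg _ 0 (r * (a + b)), mem_ballotSets.2 ⟨?_, fun j _ hj => ?_⟩, ?_⟩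
  · rw [zero_mul]
    exact Finset.inter_subset_right
  · have h1 := card_tail_eq_add I (Nat.mul_le_mul_right (a + b) hj.le)
    have h2 := hmin j hj
    have h3 : (n - j) * b = (r - j) * b + (n - r) * b := by
      rw [← add_mul]; congr 1; omega
    have h4 : tail (F ∩ seg _ 0 (r * (a + b))) (j * (a + b)) ⊆
        I ∩ seg _ (j * (a + b)) (r * (a + b)) := by
      intro p hp
      simp only [mem_tail, Finset.mem_inter, mem_seg] at hp ⊢
      exact ⟨hlow p hp.1.1 hp.1.2.2, hp.2, hp.1.2.2⟩
    have := Finset.card_le_card h4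
    omega
  · ext p
    simp only [addBlocks, Finset.mem_union, Finset.mem_inter, mem_seg]
    constructor
    · rintro (h | h)
      · exact h.1
      · exact hhigh p h.1
    · intro h
      have := p.2
      rcases lt_or_ge (p : ℕ) (r * (a + b)) with h' | h'
      · exact Or.inl ⟨h, Nat.zero_le _, h'⟩
      · exact Or.inr ⟨h', this⟩

/-- If r < r', then G' would contain all blocks from r to r' - 1, hence at least (r' - r)b elements,
against its strict bound at r. -/
theorem le_of_addBlocks_eq {r r' : ℕ} (hr' : r' ≤ n) {G G' : Finset (Fin (n * (a + b)))}
    (hG' : G' ∈ ballotSets a b n 0 r') (h : addBlocks a b n r G = addBlocks a b n r' G') :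
    r' ≤ r := by
  by_contra! hlt
  have h1 := (mem_ballotSets.1 hG').2 r (Nat.zero_le _) hlt
  have h2 : seg _ (r * (a + b)) (r' * (a + b)) ⊆ tail G' (r * (a + b)) := by
    intro p hp
    rw [mem_seg] at hp
    have h3 : p ∈ addBlocks a b n r' G' := by
      rw [← h, addBlocks, Finset.mem_union, mem_seg]
      exact Or.inr ⟨hp.1, p.2⟩
    rw [addBlocks, Finset.mem_union, mem_seg] at h3
    rw [mem_tail]
    refine ⟨h3.resolve_right fun h4 => ?_, hp.1⟩
    omega
  have h3 := Finset.card_le_card h2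
  rw [card_seg (Nat.mul_le_mul_right _ hr'), ← Nat.sub_mul] at h3
  have h4 := Nat.mul_le_mul_left (r' - r) (Nat.le_add_left b a)
  omega

theorem eq_of_addBlocks_eq {r : ℕ} {G G' : Finset (Fin (n * (a + b)))}
    (hG : G ∈ ballotSets a b n 0 r) (hG' : G' ∈ ballotSets a b n 0 r)
    (h : addBlocks a b n r G = addBlocks a b n r G') : G = G' := by
  have key : ∀ {G : Finset (Fin (n * (a + b)))}, G ∈ ballotSets a b n 0 r →
      addBlocks a b n r G \ seg _ (r * (a + b)) (n * (a + b)) = G := by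
    intro G hG
    rw [addBlocks, Finset.union_sdiff_right, Finset.sdiff_eq_self_iff_disjoint,
      Finset.disjoint_left]
    intro p hp hp'
    have h1 := mem_seg.1 ((mem_ballotSets.1 hG).1 hp)
    have h2 := mem_seg.1 hp'
    omega
  rw [← key hG, h, key hG']

theorem whitneyPoly_catalan_eq_sum :
    whitneyPoly (catalan a b n) = ∑ r ∈ Finset.range (n + 1),
      X ^ ((n - r) * b) * ∑ G ∈ ballotSets a b n 0 r, X ^ G.card := by
  classical
  simp only [whitneyPoly_eq_sum, Finset.mul_sum]
  rw [Finset.sum_sigma']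
  symm
  have hle : ∀ {r}, r ∈ Finset.range (n + 1) → r ≤ n := fun h =>
    Nat.lt_succ_iff.1 (Finset.mem_range.1 h)
  refine Finset.sum_bij (fun x _ => addBlocks a b n x.1 x.2) ?_ ?_ ?_ ?_
  · rintro ⟨r, G⟩ h
    rw [Finset.mem_sigma] at h
    exact Finset.mem_filter.2 ⟨Finset.mem_univ _, (addBlocks_flat (hle h.1) h.2).1⟩
  · rintro ⟨r, G⟩ h ⟨r', G'⟩ h' heq
    rw [Finset.mem_sigma] at h h'
    dsimp only at h h' heq
    obtain rfl : r = r' := le_antisymm (le_of_addBlocks_eq (hle h.1) h.2 heq.symm)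
      (le_of_addBlocks_eq (hle h'.1) h'.2 heq)
    rw [eq_of_addBlocks_eq h.2 h'.2 heq]
  · intro F hF
    obtain ⟨r, hr, G, hG, h⟩ := exists_eq_addBlocks_of_isFlat (Finset.mem_filter.1 hF).2
    exact ⟨⟨r, G⟩, Finset.mem_sigma.2 ⟨Finset.mem_range.2 (Nat.lt_succ_of_le hr), hG⟩, h⟩
  · rintro ⟨r, G⟩ h
    rw [Finset.mem_sigma] at h
    rw [(addBlocks_flat (hle h.1) h.2).2, pow_add]

/-! ### Generating function of the ballot sets, and conclusion -/

theorem X_pow_modByMonic_X_pow (k d : ℕ) :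
    (X ^ k : ℚ[X]) %ₘ X ^ d = if k < d then X ^ k else 0 := by
  split_ifs with h
  · rw [modByMonic_eq_self_iff (monic_X_pow d), degree_X_pow, degree_X_pow]
    exact_mod_cast h
  · rw [modByMonic_eq_zero_iff_dvd (monic_X_pow d)]
    exact pow_dvd_pow X (not_lt.1 h)

theorem sum_powerset_X_pow_card {α : Type*} [DecidableEq α] (s : Finset α) :
    ∑ G ∈ s.powerset, (X : ℚ[X]) ^ G.card = (1 + X) ^ s.card := by
  rw [← Finset.prod_const, Finset.prod_one_add]
  simp

/-- Split off block i. Its elements are free and give (1 + X)^(a+b); the conditions for j > i see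
only the remaining blocks; the condition at i bounds the total size, which is truncation at
X^((m-i)b). -/
theorem sum_ballotSets_succ {i m : ℕ} (him : i < m) (hmn : m ≤ n) :
    ∑ G ∈ ballotSets a b n i m, (X : ℚ[X]) ^ G.card =
      ((1 + X) ^ (a + b) * ∑ G ∈ ballotSets a b n (i + 1) m, X ^ G.card) %ₘ X ^ ((m - i) * b) := by
  have hi1 : i * (a + b) ≤ (i + 1) * (a + b) := Nat.mul_le_mul_right _ (by omega)
  have him' : (i + 1) * (a + b) ≤ m * (a + b) := Nat.mul_le_mul_right _ him
  have hseg : (seg (n * (a + b)) (i * (a + b)) ((i + 1) * (a + b))).card = a + b := by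
    rw [card_seg (him'.trans (Nat.mul_le_mul_right _ hmn)), add_mul, one_mul]
    omega
  have htl : ∀ G : Finset (Fin (n * (a + b))), G ⊆ seg _ (i * (a + b)) (m * (a + b)) →
      tail G (i * (a + b)) = G := by
    intro G hG
    refine Finset.filter_true_of_mem fun p hp => (mem_seg.1 (hG hp)).1
  have hpow : (1 + X : ℚ[X]) ^ (a + b) =
      ∑ G ∈ (seg (n * (a + b)) (i * (a + b)) ((i + 1) * (a + b))).powerset, X ^ G.card := by
    rw [sum_powerset_X_pow_card, hseg]
  rw [hpow, Finset.sum_mul_sum, ← Finset.sum_product']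
  change _ = modByMonicHom (X ^ ((m - i) * b)) _
  rw [map_sum]
  simp only [modByMonicHom_apply, ← pow_add, X_pow_modByMonic_X_pow]
  rw [← Finset.sum_filter]
  refine Finset.sum_bij' (fun G _ => (G ∩ seg _ (i * (a + b)) ((i + 1) * (a + b)),
    tail G ((i + 1) * (a + b)))) (fun x _ => x.1 ∪ x.2) ?_ ?_ ?_ ?_ ?_
  · intro G hG
    rw [mem_ballotSets] at hG
    rw [Finset.mem_filter, Finset.mem_product, Finset.mem_powerset, mem_ballotSets]
    refine ⟨⟨Finset.inter_subset_right, fun p hp => ?_, fun j hij hjm => ?_⟩, ?_⟩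
    · rw [mem_tail] at hp
      exact mem_seg.2 ⟨hp.2, (mem_seg.1 (hG.1 hp.1)).2⟩
    · rw [tail_tail_of_ge _ (Nat.mul_le_mul_right _ hij)]
      exact hG.2 j (by omega) hjm
    · rw [← card_tail_eq_add G hi1]
      exact hG.2 i le_rfl him
  · rintro ⟨A, B⟩ h
    rw [Finset.mem_filter, Finset.mem_product, Finset.mem_powerset, mem_ballotSets] at h
    obtain ⟨⟨hA, hB, hBb⟩, hcard⟩ := h
    dsimp only at hA hB hBb hcard
    rw [mem_ballotSets]
    refine ⟨fun p hp => ?_, fun j hij hjm => ?_⟩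
    · rw [mem_seg]
      rcases Finset.mem_union.1 hp with hp | hp
      · have := mem_seg.1 (hA hp)
        omega
      · have := mem_seg.1 (hB hp)
        omega
    · rcases hij.eq_or_lt with rfl | hij
      · exact ((Finset.card_filter_le _ _).trans (Finset.card_union_le A B)).trans_lt hcard
      · rw [tail_union, Finset.subset_empty.1 ((tail_antitone A
          (Nat.mul_le_mul_right (a + b) hij)).trans (tail_eq_empty_of_subset_seg hA).subset),
          Finset.empty_union]
        exact hBb j hij hjm
  · intro G hG
    ext p
    simp only [Finset.mem_union, Finset.mem_inter, mem_seg, mem_tail]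
    constructor
    · rintro (h | h) <;> exact h.1
    · intro h
      have := mem_seg.1 ((mem_ballotSets.1 hG).1 h)
      rcases lt_or_ge (p : ℕ) ((i + 1) * (a + b)) with h' | h'
      · exact Or.inl ⟨h, this.1, h'⟩
      · exact Or.inr ⟨h, h'⟩
  · rintro ⟨A, B⟩ h
    rw [Finset.mem_filter, Finset.mem_product, Finset.mem_powerset, mem_ballotSets] at h
    obtain ⟨⟨hA, hB, -⟩, -⟩ := h
    dsimp only at hA hB ⊢
    have hBtail : tail B ((i + 1) * (a + b)) = B :=
      Finset.filter_true_of_mem fun p hp => (mem_seg.1 (hB hp)).1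
    have hBA : B ∩ seg _ (i * (a + b)) ((i + 1) * (a + b)) = ∅ := by
      refine Finset.eq_empty_of_forall_notMem fun p hp => ?_
      rw [Finset.mem_inter, mem_seg] at hp
      have := mem_seg.1 (hB hp.1)
      omega
    rw [tail_union, tail_eq_empty_of_subset_seg hA, hBtail, Finset.empty_union,
      Finset.union_inter_distrib_right, hBA, Finset.union_empty, Finset.inter_eq_left.2 hA]
  · intro G hG
    rw [← card_tail_eq_add G hi1, htl G (mem_ballotSets.1 hG).1]

/-- The index k counts blocks from the right end, since the truncation exponent depends on the
distance to m. -/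
theorem sum_ballotSets_eq_truncIter {k m : ℕ} (hkm : k ≤ m) (hmn : m ≤ n) :
    ∑ G ∈ ballotSets a b n (m - k) m, (X : ℚ[X]) ^ G.card = truncIter ((1 + X) ^ (a + b)) b k := by
  induction k with
  | zero =>
    have : ballotSets a b n m m = {∅} := by
      ext G
      rw [mem_ballotSets, Finset.mem_singleton]
      constructor
      · rintro ⟨h, -⟩
        refine Finset.eq_empty_of_forall_notMem fun p hp => ?_
        have := mem_seg.1 (h hp)
        omega
      · rintro rfl
        exact ⟨Finset.empty_subset _, fun j h1 h2 => by omega⟩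
    rw [Nat.sub_zero, this, truncIter]
    simp
  | succ k ih =>
    rw [sum_ballotSets_succ (by omega) hmn, show m - (k + 1) + 1 = m - k by omega, ih (by omega),
      truncIter, show m - (m - (k + 1)) = k + 1 by omega]

theorem whitneyPoly_catalan (a b n : ℕ) : whitneyPoly (catalan a b n) =
    ∑ μ : n.Partition, C (1 / (zNumber μ : ℚ)) * whitneyPoly (uniformPartition a b μ) := by
  have h1 : ∀ r ∈ Finset.range (n + 1), (X : ℚ[X]) ^ ((n - r) * b) *
      ∑ G ∈ ballotSets a b n 0 r, X ^ G.card =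
      X ^ ((n - r) * b) * truncIter ((1 + X) ^ (a + b)) b r := fun r hr => by
    rw [← sum_ballotSets_eq_truncIter le_rfl (Nat.lt_succ_iff.1 (Finset.mem_range.1 hr)),
      Nat.sub_self]
  rw [whitneyPoly_catalan_eq_sum, Finset.sum_congr rfl h1, sum_pow_mul_truncIter,
    ← sum_partition_eq_expCoeff]
  refine Finset.sum_congr rfl fun μ _ => ?_
  rw [whitneyPoly_uniformPartition, smul_eq_C_mul]
  congr 4
  funext m
  rw [uniformAB, whitneyPoly_uniform_eq_modByMonic, ← pow_mul, mul_comm (a + b)]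

end Catalan

end CatalanMatroid

theorem corollary4p7 (a b : ℕ) (ha : 1 ≤ a) (hb : 1 ≤ b) :
    -- the formula for the Whitney polynomial of the `(a,b)`-Catalan matroid
    (∀ n : ℕ, CatalanMatroid.whitneyPoly (CatalanMatroid.catalan a b n) =
      ∑ μ : n.Partition, C (1 / (CatalanMatroid.zNumber μ : ℚ)) *
        CatalanMatroid.whitneyPoly (CatalanMatroid.uniformPartition a b μ)) ∧
    -- the Whitney polynomial of the direct sum is the product over its uniform summands
    (∀ (n : ℕ) (μ : n.Partition),
      CatalanMatroid.whitneyPoly (CatalanMatroid.uniformPartition a b μ) =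
        (μ.parts.map fun m => CatalanMatroid.whitneyPoly (CatalanMatroid.uniformAB a b m)).prod) ∧
    -- the Whitney polynomial of a uniform matroid
    (∀ (k N : ℕ) (h : k ≤ N), CatalanMatroid.whitneyPoly (CatalanMatroid.uniform k N h) =
      ∑ i ∈ Finset.range k, C (N.choose i : ℚ) * X ^ i + X ^ k) := by
  exact ⟨CatalanMatroid.whitneyPoly_catalan a b,
    fun _ μ => CatalanMatroid.whitneyPoly_uniformPartition a b μ,
    fun _ _ h => CatalanMatroid.whitneyPoly_uniform h⟩
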